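/- A zero-mean real source $X$ has a density and finite variance $\sigma_X^2$. A transmitter sends $Y$, a jammer that observes $X$ adds $Z$, and a receiver that observes $U=Y+Z+N$ forms an estimate $\hat X$. The channel noise $N\sim\mathcal N(0,\sigma_N^2)$, $\sigma_N^2>0$, is independent of everything else. The transmitter and the receiver may share a random seed $\gamma$, independent of $(X,Z,N)$: $Y=g(\gamma,X)$ and $\hat X=h(\gamma,U)$ with $g,h$ measurable and $\mathbb E[Y^2]\le P_T$, where $P_T>0$. The jammer chooses the conditional law of $Z$ given $X$, with $\mathbb E[Z^2]\le P_A$, where $P_A\ge 0$. The cost $J=\mathbb E[(X-\hat X)^2]\in[0,\infty]$ is minimized by the transmitter and the receiver and maximized by the jammer. Put $\beta=(P_A+\sigma_N^2)/P_T$ and $\alpha_T=\sqrt{P_T/\sigma_X^2}$, and write $F_V$ for the characteristic function of $V$. Theorem (low CSNR, Gaussian channel). Whatever the density of $X$, Gaussian jamming $Z\sim\mathcal N(0,P_A)$ independent of the source is asymptotically optimal as $\beta\to\infty$. Precisely, for all $\varepsilon,T>0$ there is $\beta_0>0$, depending only on $\varepsilon$, $T$ and the law of $X$, such that for all $P_T,P_A,\sigma_N^2$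 as above with $\beta\ge\beta_0$ and for $Z\sim\mathcal N(0,P_A)$ independent of $(X,N,\gamma)$: (a) the matching condition $F_ZF_N=F_X^{\beta}(\alpha_T\,\cdot)$ holds up to $\varepsilon$, that is, $|F_Z(\omega)F_N(\omega)-F_X(\alpha_T\omega)^{\beta}|\le\varepsilon$ for all $\omega\in\mathbb R$, and $\left|F_Z(\omega)-F_X(\alpha_T\omega)^{\beta}/F_N(\omega)\right|\le\varepsilon$ whenever $|\omega|\sqrt{P_A+\sigma_N^2}\le T$ (principal branch of the power); (b) this jammer and the randomized linear policy $Y=\gamma\alpha_TX$, $\hat X=\gamma\,\frac{\alpha_T\sigma_X^2}{P_T+P_A+\sigma_N^2}\,U$, with $\gamma$ uniform on $\{-1,1\}$, are admissible and form a saddle point up to $\varepsilon$: against the linear policy no admissible jammer yields a larger cost, and against Gaussian jamming no admissible transmitter and receiver yield a cost smaller by more than $\varepsilon$; the cost of the pair is $\frac{\sigma_X^2(P_A+\sigma_N^2)}{P_T+P_A+\sigma_N^2}$; (c) for every admissible jammer, the infimum of the cost over all admissible transmitter and receiver policies exceeds the corresponding infimum for Gaussian jamming by at most $\varepsilon$.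 -/

import Mathlib

open MeasureTheory ProbabilityTheory
open scoped NNReal ENNReal

noncomputable section

namespace Jamming

/-- A joint policy of the transmitter and the receiver. Both know a common random seed `r`
with law `seed`, drawn independently of everything else (a deterministic pair of mappings is
the case of a point mass). The transmitter sends `Y = enc r X`, and the receiver forms the
estimate `dec r U` from the received signal `U`. -/
structure CommPolicy where
  seed : Measure ℝ
  seed_prob : IsProbabilityMeasure seed
  enc : ℝ → ℝ → ℝ
  dec : ℝ → ℝ → ℝ
  measurable_enc : Measurable (Function.uncurry enc)
  measurable_dec : Measurable (Function.uncurry dec)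

/-- A (possibly randomized) jamming policy: the conditional law of the jamming signal `Z`
given the source `X`, which the jammer observes. A deterministic mapping `g_A` is the case
`Kernel.deterministic g_A _`. -/
structure Jammer where
  kernel : Kernel ℝ ℝ
  markov : IsMarkovKernel kernel

/-- The transmitter's power constraint `E[Y²] ≤ P_T`, for a source with law `μX`. -/
def CommPolicy.Admissible (p : CommPolicy) (μX : Measure ℝ) (PT : ℝ≥0) : Prop :=
  ∫⁻ r, ∫⁻ x, ENNReal.ofReal (p.enc r x ^ 2) ∂μX ∂p.seed ≤ PT

/-- The jammer's power constraint `E[Z²] ≤ P_A`, for a source with law `μX`. -/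
def Jammer.Admissible (A : Jammer) (μX : Measure ℝ) (PA : ℝ≥0) : Prop :=
  ∫⁻ x, ∫⁻ z, ENNReal.ofReal (z ^ 2) ∂(A.kernel x) ∂μX ≤ PA

/-- The mean squared error `E[(X - X̂)²]`, in `[0, ∞]`, where `X̂ = dec r U` and
`U = enc r X + Z + N`; here `X` has law `μX`, the noise `N` has law `μN` and is independent
of `(r, X, Z)`, and the seed `r` is independent of `(X, Z, N)`. -/
def cost (μX μN : Measure ℝ) (p : CommPolicy) (A : Jammer) : ℝ≥0∞ :=
  ∫⁻ r, ∫⁻ x, ∫⁻ z, ∫⁻ n,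
    ENNReal.ofReal ((x - p.dec r (p.enc r x + z + n)) ^ 2) ∂μN ∂(A.kernel x) ∂μX ∂p.seed

/-- The distortion that the jamming policy `A` guarantees: the smallest (infimal) cost that
a transmitter of power `P_T` and a receiver can achieve against it. -/
def guaranteedCost (μX μN : Measure ℝ) (PT : ℝ≥0) (A : Jammer) : ℝ≥0∞ :=
  ⨅ (p : CommPolicy) (_ : p.Admissible μX PT), cost μX μN p A

/-- The pair `(p, A)` is a saddle point of the jamming game up to `ε`: both policies meet
their power constraints, no admissible jammer does better than `A` against `p`, and no
admissible transmitter-receiver pair improves on `p` against `A` by more than `ε`. -/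
def IsSaddleUpTo (ε : ℝ≥0∞) (μX μN : Measure ℝ) (PT PA : ℝ≥0)
    (p : CommPolicy) (A : Jammer) : Prop :=
  p.Admissible μX PT ∧ A.Admissible μX PA ∧
  (∀ A' : Jammer, A'.Admissible μX PA → cost μX μN p A' ≤ cost μX μN p A) ∧
  (∀ p' : CommPolicy, p'.Admissible μX PT → cost μX μN p A ≤ cost μX μN p' A + ε)

/-- Gaussian jamming `Z ∼ 𝒩(0, P_A)`, independent of the source. -/
def gaussianJammer (PA : ℝ≥0) : Jammer where
  kernel := Kernel.const ℝ (gaussianReal 0 PA)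
  markov := inferInstance

/-- The law of a fair sign, uniform on `{-1, 1}`. -/
def fairSign : Measure ℝ :=
  (2⁻¹ : ℝ≥0∞) • Measure.dirac (1 : ℝ) + (2⁻¹ : ℝ≥0∞) • Measure.dirac (-1 : ℝ)

theorem isProbabilityMeasure_fairSign : IsProbabilityMeasure fairSign :=
  ⟨by simp [fairSign, ENNReal.inv_two_add_inv_two]⟩

/-- The gain `α_T = √(P_T / σ_X²)` of the linear transmitter. -/
def gain (PT : ℝ≥0) (varX : ℝ) : ℝ := Real.sqrt ((PT : ℝ) / varX)

/-- The randomized linear policy: `Y = γ α_T X` with a fair sign `γ` known to the receiver,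
which uses the best linear estimate `γ (α_T σ_X² / (P_T + P_A + σ_N²)) U`. -/
def linearPolicy (PT PA varN : ℝ≥0) (varX : ℝ) : CommPolicy where
  seed := fairSign
  seed_prob := isProbabilityMeasure_fairSign
  enc := fun γ x => γ * gain PT varX * x
  dec := fun γ u => γ * (gain PT varX * varX / (PT + PA + varN)) * u
  measurable_enc := by unfold Function.uncurry; fun_prop
  measurable_dec := by unfold Function.uncurry; fun_prop

/-- The inverse channel signal-to-noise ratio `β = (P_A + σ_N²) / P_T`. -/
def invCSNR (PT PA varN : ℝ≥0) : ℝ := ((PA : ℝ) + varN) / PT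

end Jamming

end

/-!
Write `φ` for the characteristic function of the source, `v > 0` for its variance,
`s = P_A + σ_N²` for the total noise power and `b = s / P_T`.

*Matching.* The claim is that `φ(u) ^ b` is close to `exp (-b v u² / 2)` uniformly in `u` once `b`
is large; at `u = α_T ω` the exponent is `-s ω² / 2`, the one of the total noise. Near the origin
`log φ(u) = -v u² / 2 + o(u²)`, and the Gaussian decay absorbs the factor `exp (b o(u²))`
(`exists_charFun_cpow_near_zero`). Away from the origin both terms are exponentially small in `b`:
because the source has a density, `|φ| < 1` off the origin (`norm_charFun_lt_one`) and `φ` vanishes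
at infinity, hence `|φ|` stays below some `η < 1` (`exists_norm_charFun_le`).

*The linear policy.* Averaging over the fair sign cancels the correlation of the jamming signal with
the source, so the cost depends on the jammer only through its power, and is increasing in it
(`Jamming.cost_linearPolicy`).

*Gaussian jamming.* The cost of the linear policy is at most `v`, the error of the constant
estimate `0`, and against Gaussian jamming at low signal-to-noise ratio no policy is much better
(`Jamming.exists_variance_le_cost_gaussianJammer`). Indeed, a shift of the noise by `y` changes the
expectation of a bounded function only by a small amount governed by `y² / s`
(`lintegral_gaussianReal_le_shift`), and the mean of `Y² / s` is at most `1 / b`. So for a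
truncated loss the received signal may be replaced by noise independent of the source, and then the
loss is nearly `v` for every estimate (`exists_truncated_variance_le`).

The bound on the guaranteed distortion of an arbitrary jammer follows from the saddle point: the
linear policy is one of the policies over which the infimum is taken.
-/

/-! ### Powers of characteristic functions -/

section charFun

open Filter Topology Asymptotics

theorem charFun_isLittleO_two {μ : Measure ℝ} [IsProbabilityMeasure μ]
    (hvar : MemLp (fun x : ℝ => x) 2 μ) (hmean : ∫ x, x ∂μ = 0) {v : ℝ}
    (hv : v = ∫ x, x ^ 2 ∂μ) :
    (fun u : ℝ => charFun μ u - (1 - v * u ^ 2 / 2)) =o[𝓝 0] fun u : ℝ => u ^ 2 := by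
  have hid : MemLp id 2 μ := hvar
  have hT : ∀ u : ℝ, taylorWithinEval (charFun μ) 2 Set.univ 0 u = 1 - v * u ^ 2 / 2 := by
    intro u
    have h := taylorWithinEval_charFun_two_zero (P := μ) (X := id) aemeasurable_id
      (by simpa using hid) u
    simp only [Measure.map_id, id_eq, Pi.pow_apply, hmean, ← hv] at h
    simpa using h
  have h2 : ContDiff ℝ (2 : ℕ) (charFun μ) := contDiff_charFun (by simpa using hid)
  have h := taylor_isLittleO_univ (x₀ := (0 : ℝ)) h2
  simpa only [hT, sub_zero] using h

theorem log_charFun_isLittleO_two {μ : Measure ℝ} [IsProbabilityMeasure μ]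
    (hvar : MemLp (fun x : ℝ => x) 2 μ) (hmean : ∫ x, x ∂μ = 0) {v : ℝ}
    (hv : v = ∫ x, x ^ 2 ∂μ) :
    (fun u : ℝ => Complex.log (charFun μ u) + v * u ^ 2 / 2) =o[𝓝 0] fun u : ℝ => u ^ 2 := by
  have h1 := charFun_isLittleO_two hvar hmean hv
  have hφ0 : charFun μ 0 = 1 := by simp
  have hcont : Tendsto (charFun μ) (𝓝 0) (𝓝 1) := by
    have := (continuous_charFun (μ := μ)).tendsto 0
    rwa [hφ0] at this
  have hq : (fun u : ℝ => (v * u ^ 2 / 2 : ℂ)) =O[𝓝 0] fun u : ℝ => u ^ 2 := by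
    refine IsBigO.of_bound (|v| / 2) (Eventually.of_forall fun u => ?_)
    simp only [norm_div, norm_mul, norm_pow, Complex.norm_real, Complex.norm_ofNat,
      Real.norm_eq_abs]
    exact le_of_eq (by ring)
  have hO : (fun u : ℝ => charFun μ u - 1) =O[𝓝 0] fun u : ℝ => u ^ 2 := by
    refine (h1.isBigO.sub hq).congr_left fun u => ?_
    ring
  have hlog : (fun w : ℂ => Complex.log w - (w - 1)) =o[𝓝 1] fun w => w - 1 := by
    have h := (Complex.hasDerivAt_log Complex.one_mem_slitPlane).isLittleO
    simpa using h
  refine (((hlog.comp_tendsto hcont).trans_isBigO hO).add h1).congr_left fun u => ?_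
  simp only [Function.comp]
  ring

/-- Near the origin, a power `φ ^ b` of the characteristic function of a centered law is
uniformly close to the Gaussian `exp (-b v u² / 2)`, no matter how large `b` is: the relative
error `exp (b o(u²)) - 1` is absorbed by the Gaussian decay. -/
theorem exists_charFun_cpow_near_zero {μ : Measure ℝ} [IsProbabilityMeasure μ]
    (hvar : MemLp (fun x : ℝ => x) 2 μ) (hmean : ∫ x, x ∂μ = 0) {v : ℝ}
    (hv : v = ∫ x, x ^ 2 ∂μ) (hv0 : 0 < v) {ε : ℝ} (hε : 0 < ε) :
    ∃ δ : ℝ, 0 < δ ∧ ∀ b : ℝ, 0 < b → ∀ u : ℝ, |u| < δ →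
      ‖charFun μ u ^ (b : ℂ) - (Real.exp (-(b * v * u ^ 2 / 2)) : ℂ)‖ ≤ ε := by
  set κ : ℝ := min (v / 4) (ε * v / 4) with hκ
  have hκ0 : 0 < κ := lt_min (by positivity) (by positivity)
  have hlog := (log_charFun_isLittleO_two hvar hmean hv).def hκ0
  have hne : ∀ᶠ u in 𝓝 (0 : ℝ), charFun μ u ≠ 0 :=
    (continuous_charFun (μ := μ)).continuousAt.eventually_ne (by simp)
  obtain ⟨δ, hδ, H⟩ := Metric.eventually_nhds_iff.1 (hlog.and hne)
  refine ⟨δ, hδ, fun b hb u hu => ?_⟩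
  obtain ⟨h1, h2⟩ := H (y := u) (by simpa using hu)
  set ρ : ℂ := Complex.log (charFun μ u) + v * u ^ 2 / 2 with hρ
  set q : ℝ := b * u ^ 2 with hq
  have hq0 : 0 ≤ q := by positivity
  have hbρ : ‖(b : ℂ) * ρ‖ ≤ κ * q := by
    rw [norm_mul, Complex.norm_real, Real.norm_of_nonneg hb.le]
    calc b * ‖ρ‖ ≤ b * (κ * ‖u ^ 2‖) := by gcongr
      _ = κ * q := by rw [Real.norm_of_nonneg (sq_nonneg u), hq]; ring
  have hsplit : charFun μ u ^ (b : ℂ) - (Real.exp (-(b * v * u ^ 2 / 2)) : ℂ)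
      = (Real.exp (-(v * q / 2)) : ℂ) * (Complex.exp (b * ρ) - 1) := by
    rw [Complex.cpow_def_of_ne_zero h2, mul_sub, mul_one, Complex.ofReal_exp, Complex.ofReal_exp,
      ← Complex.exp_add]
    congr 2
    · rw [hρ, hq]; push_cast; ring
    · rw [hq]; congr 2; ring
  have hexp : ‖Complex.exp (b * ρ) - 1‖ ≤ κ * q * Real.exp (κ * q) := by
    have h := Complex.norm_exp_sub_sum_le_norm_mul_exp ((b : ℂ) * ρ) 1
    simp only [Finset.range_one, Finset.sum_singleton, pow_zero, Nat.factorial_zero, Nat.cast_one,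
      div_one, pow_one] at h
    refine h.trans ?_
    gcongr
  have hκv : κ ≤ v / 4 := min_le_left _ _
  have hκε : κ ≤ ε * v / 4 := min_le_right _ _
  rw [hsplit, norm_mul, Complex.norm_real, Real.norm_of_nonneg (Real.exp_pos _).le]
  have hx : v * q / 4 * Real.exp (-(v * q / 4)) ≤ 1 := by
    have := Real.add_one_le_exp (v * q / 4)
    rw [Real.exp_neg, ← div_eq_mul_inv, div_le_one (Real.exp_pos _)]
    linarith
  calc Real.exp (-(v * q / 2)) * ‖Complex.exp (b * ρ) - 1‖
      ≤ Real.exp (-(v * q / 2)) * (ε * v / 4 * q * Real.exp (v / 4 * q)) := by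
        gcongr
        exact hexp.trans (by gcongr)
    _ = ε * (v * q / 4 * Real.exp (-(v * q / 4))) := by
        have : Real.exp (-(v * q / 4)) = Real.exp (-(v * q / 2)) * Real.exp (v / 4 * q) := by
          rw [← Real.exp_add]; congr 1; ring
        rw [this]; ring
    _ ≤ ε := by nlinarith

/-- The characteristic function of a law with a density has modulus less than `1` off the origin:
otherwise `u x` would be constant modulo `2π` almost surely, and `x` would range over a
countable set. -/
theorem norm_charFun_lt_one {μ : Measure ℝ} [IsProbabilityMeasure μ] (hd : μ ≪ volume)
    {u : ℝ} (hu : u ≠ 0) : ‖charFun μ u‖ < 1 := by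
  refine lt_of_le_of_ne (norm_charFun_le_one u) fun h1 => ?_
  set φ := charFun μ u with hφ
  have hcharint : Integrable (fun x : ℝ => Complex.exp (u * x * Complex.I)) μ := by
    refine Integrable.of_bound (by fun_prop) 1 (ae_of_all _ fun x => ?_)
    rw [← Complex.ofReal_mul, Complex.norm_exp_ofReal_mul_I]
  have hconj : (starRingEnd ℂ φ) * φ = 1 := by
    rw [← Complex.normSq_eq_conj_mul_self, Complex.normSq_eq_norm_sq, h1]; simp
  -- the real part of `conj φ * exp (i u x)` is at most `1` and has mean `1`
  have hg : ∫ x : ℝ, (1 - (starRingEnd ℂ φ * Complex.exp (u * x * Complex.I)).re) ∂μ = 0 := by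
    have hi := hcharint.const_mul (starRingEnd ℂ φ)
    have hire : Integrable (fun x : ℝ =>
        (starRingEnd ℂ φ * Complex.exp (u * x * Complex.I)).re) μ := hi.re
    rw [integral_sub (integrable_const _) hire]
    have : ∫ x : ℝ, (starRingEnd ℂ φ * Complex.exp (u * x * Complex.I)).re ∂μ
        = (∫ x : ℝ, starRingEnd ℂ φ * Complex.exp (u * x * Complex.I) ∂μ).re :=
      integral_re hi
    rw [this, integral_const_mul, ← charFun_apply_real, ← hφ, hconj]
    simp
  have hnorm : ∀ x : ℝ, ‖starRingEnd ℂ φ * Complex.exp (u * x * Complex.I)‖ = 1 := fun x => by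
    rw [norm_mul, ← Complex.ofReal_mul, Complex.norm_exp_ofReal_mul_I, RCLike.norm_conj, h1,
      mul_one]
  have hae := (integral_eq_zero_iff_of_nonneg (μ := μ) (fun x => by
      have := Complex.re_le_norm (starRingEnd ℂ φ * Complex.exp (u * x * Complex.I))
      rw [hnorm] at this
      simpa using this)
    ((integrable_const _).sub (hcharint.const_mul (starRingEnd ℂ φ)).re)).1 hg
  have hexp : ∀ᵐ x : ℝ ∂μ, Complex.exp (u * x * Complex.I) = φ := by
    filter_upwards [hae] with x hx
    have hre : (starRingEnd ℂ φ * Complex.exp (u * x * Complex.I)).re = 1 :=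
      (sub_eq_zero.1 hx).symm
    have : starRingEnd ℂ φ * Complex.exp (u * x * Complex.I) = 1 := by
      have h2 := hnorm x
      have h3 := Complex.sq_norm_sub_sq_re (starRingEnd ℂ φ * Complex.exp (u * x * Complex.I))
      rw [h2, hre] at h3
      apply Complex.ext
      · simpa using hre
      · simp only [Complex.one_im]; nlinarith
    calc Complex.exp (u * x * Complex.I)
        = (starRingEnd ℂ φ * φ) * Complex.exp (u * x * Complex.I) := by rw [hconj, one_mul]
      _ = φ * (starRingEnd ℂ φ * Complex.exp (u * x * Complex.I)) := by ring
      _ = φ := by rw [this, mul_one]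
  have hcount : Set.Countable {x : ℝ | Complex.exp (u * x * Complex.I) = φ} := by
    rcases Set.eq_empty_or_nonempty {x : ℝ | Complex.exp (u * x * Complex.I) = φ} with h | ⟨x₀, hx₀⟩
    · rw [h]; exact Set.countable_empty
    · refine (Set.countable_range fun n : ℤ => x₀ + n * (2 * Real.pi) / u).mono fun x hx => ?_
      have hxx : Complex.exp (u * x * Complex.I) = Complex.exp (u * x₀ * Complex.I) :=
        (Eq.trans hx (Eq.symm hx₀))
      obtain ⟨n, hn⟩ := Complex.exp_eq_exp_iff_exists_int.1 hxx
      refine ⟨n, ?_⟩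
      have h4 : ((u * x : ℝ) : ℂ) = ((u * x₀ + n * (2 * Real.pi) : ℝ) : ℂ) := by
        apply mul_right_cancel₀ Complex.I_ne_zero
        push_cast
        rw [hn]; ring
      have h5 := Complex.ofReal_injective h4
      simp only
      field_simp
      linarith
  have hz : μ {x : ℝ | Complex.exp (u * x * Complex.I) = φ} = 0 := hd (hcount.measure_zero volume)
  have hone : μ {x : ℝ | Complex.exp (u * x * Complex.I) = φ} = 1 := by
    rw [← measure_univ (μ := μ)]; exact measure_congr (eventuallyEq_univ.2 hexp)
  exact zero_ne_one (hz.symm.trans hone)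

/-- **Riemann-Lebesgue lemma** for characteristic functions. -/
theorem tendsto_charFun_cocompact {μ : Measure ℝ} [IsProbabilityMeasure μ] (hd : μ ≪ volume) :
    Tendsto (charFun μ) (cocompact ℝ) (𝓝 0) := by
  have h := Real.tendsto_integral_exp_smul_cocompact
    (fun x => ((μ.rnDeriv volume x).toReal : ℂ))
  -- the frequency `u` of `charFun` corresponds to `-u / (2π)` for the Fourier character
  have hscale : Tendsto (fun u : ℝ => (-(2 * Real.pi)⁻¹) * u) (cocompact ℝ) (cocompact ℝ) :=
    tendsto_cocompact_mul_left₀ (by simp [Real.pi_ne_zero])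
  refine (h.comp hscale).congr fun u => ?_
  simp only [Function.comp]
  rw [charFun_apply_real, ← integral_rnDeriv_smul hd]
  refine integral_congr_ae (ae_of_all _ fun x => ?_)
  simp only [Circle.smul_def, Real.fourierChar_apply, smul_eq_mul, Complex.real_smul]
  rw [mul_comm]
  congr 2
  push_cast
  field_simp

theorem exists_norm_charFun_le {μ : Measure ℝ} [IsProbabilityMeasure μ] (hd : μ ≪ volume)
    {δ : ℝ} (hδ : 0 < δ) :
    ∃ η : ℝ, 0 < η ∧ η < 1 ∧ ∀ u : ℝ, δ ≤ |u| → ‖charFun μ u‖ ≤ η := by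
  have h := (tendsto_charFun_cocompact hd).norm
  rw [norm_zero] at h
  have hev := h.eventually_le_const (show (0 : ℝ) < 1 / 2 by norm_num)
  obtain ⟨K, hK, hKs⟩ := mem_cocompact.1 hev
  have hK' : IsCompact (K ∩ {u : ℝ | δ ≤ |u|}) :=
    hK.inter_right (isClosed_le continuous_const continuous_abs)
  obtain ⟨η, hη0, hη1, hη⟩ : ∃ η : ℝ, 0 < η ∧ η < 1 ∧
      ∀ u ∈ K ∩ {u : ℝ | δ ≤ |u|}, ‖charFun μ u‖ ≤ η := by
    rcases (K ∩ {u : ℝ | δ ≤ |u|}).eq_empty_or_nonempty with he | hne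
    · exact ⟨1 / 2, by norm_num, by norm_num, by simp [he]⟩
    · obtain ⟨u₀, hu₀, hmax⟩ := hK'.exists_isMaxOn hne
        (continuous_charFun (μ := μ)).norm.continuousOn
      have hu₀' : u₀ ≠ 0 := by
        rintro rfl
        have : δ ≤ |(0 : ℝ)| := hu₀.2
        simp only [abs_zero] at this
        linarith
      exact ⟨max (1 / 2) ‖charFun μ u₀‖, by positivity,
        max_lt (by norm_num) (norm_charFun_lt_one hd hu₀'),
        fun u hu => (hmax hu).trans (le_max_right _ _)⟩
  refine ⟨max (1 / 2) η, by positivity, max_lt (by norm_num) hη1, fun u hu => ?_⟩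
  by_cases hm : u ∈ K
  · exact (hη u ⟨hm, hu⟩).trans (le_max_right _ _)
  · exact le_trans (hKs hm) (le_max_left _ _)

/-- A central limit theorem for real powers of a characteristic function, uniform over *all*
frequencies; uniformity uses that the law has a density. -/
theorem exists_charFun_cpow_close_gaussian {μ : Measure ℝ} [IsProbabilityMeasure μ]
    (hd : μ ≪ volume) (hvar : MemLp (fun x : ℝ => x) 2 μ) (hmean : ∫ x, x ∂μ = 0) {v : ℝ}
    (hv : v = ∫ x, x ^ 2 ∂μ) (hv0 : 0 < v) {ε : ℝ} (hε : 0 < ε) :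
    ∃ b₀ : ℝ, 0 < b₀ ∧ ∀ b : ℝ, b₀ ≤ b → ∀ u : ℝ,
      ‖charFun μ u ^ (b : ℂ) - (Real.exp (-(b * v * u ^ 2 / 2)) : ℂ)‖ ≤ ε := by
  obtain ⟨δ, hδ, hnear⟩ := exists_charFun_cpow_near_zero hvar hmean hv hv0 hε
  obtain ⟨η, hη0, hη1, hη⟩ := exists_norm_charFun_le hd hδ
  have h1 : ∀ᶠ b : ℝ in atTop, η ^ b ≤ ε / 2 :=
    (tendsto_rpow_atTop_of_base_lt_one η (by linarith) hη1).eventually_le_const (by positivity)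
  have h2 : ∀ᶠ b : ℝ in atTop, Real.exp (-(b * (v * δ ^ 2 / 2))) ≤ ε / 2 :=
    (Real.tendsto_exp_neg_atTop_nhds_zero.comp
      (tendsto_id.atTop_mul_const (by positivity))).eventually_le_const (by positivity)
  obtain ⟨b₁, hb₁⟩ := eventually_atTop.1 (h1.and h2)
  refine ⟨max 1 b₁, by positivity, fun b hb u => ?_⟩
  have hb0 : 0 < b := lt_of_lt_of_le one_pos ((le_max_left _ _).trans hb)
  obtain ⟨h3, h4⟩ := hb₁ b ((le_max_right _ _).trans hb)
  rcases lt_or_ge |u| δ with hu | hu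
  · exact hnear b hb0 u hu
  · refine (norm_sub_le _ _).trans ?_
    rw [Complex.norm_cpow_real, Complex.norm_real, Real.norm_of_nonneg (Real.exp_pos _).le]
    have h5 : ‖charFun μ u‖ ^ b ≤ η ^ b := Real.rpow_le_rpow (norm_nonneg _) (hη u hu) hb0.le
    have h6 : Real.exp (-(b * v * u ^ 2 / 2)) ≤ Real.exp (-(b * (v * δ ^ 2 / 2))) := by
      have hsq : δ ^ 2 ≤ u ^ 2 := by
        rw [← sq_abs u]; gcongr
      rw [Real.exp_le_exp, neg_le_neg_iff]
      calc b * (v * δ ^ 2 / 2) ≤ b * (v * u ^ 2 / 2) := by gcongr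
        _ = b * v * u ^ 2 / 2 := by ring
    linarith

end charFun

/-! ### The linear policy against an arbitrary jammer -/

section linear

theorem lintegral_ofReal_sq {μ : Measure ℝ} (hvar : MemLp (fun x : ℝ => x) 2 μ) :
    ∫⁻ x, ENNReal.ofReal (x ^ 2) ∂μ = ENNReal.ofReal (∫ x, x ^ 2 ∂μ) :=
  (ofReal_integral_eq_lintegral_ofReal hvar.integrable_sq (ae_of_all _ fun x => sq_nonneg x)).symm

theorem memLp_two_gaussianReal (v : ℝ≥0) : MemLp (fun x : ℝ => x) 2 (gaussianReal 0 v) :=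
  memLp_id_gaussianReal 2

theorem integral_sq_gaussianReal (v : ℝ≥0) : ∫ x, x ^ 2 ∂(gaussianReal 0 v) = v := by
  have h := variance_fun_id_gaussianReal (μ := 0) (v := v)
  rwa [variance_of_integral_eq_zero (by fun_prop) (by simp)] at h

theorem lintegral_sq_gaussianReal (v : ℝ≥0) :
    ∫⁻ x, ENNReal.ofReal (x ^ 2) ∂(gaussianReal 0 v) = v := by
  rw [lintegral_ofReal_sq (memLp_two_gaussianReal v), integral_sq_gaussianReal,
    ENNReal.ofReal_coe_nnreal]

theorem lintegral_affine_sq_gaussianReal (v : ℝ≥0) (p q : ℝ) :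
    ∫⁻ n, ENNReal.ofReal ((p + q * n) ^ 2) ∂(gaussianReal 0 v)
      = ENNReal.ofReal (p ^ 2 + q ^ 2 * v) := by
  have h1 : Integrable (fun n : ℝ => n) (gaussianReal 0 v) :=
    (memLp_two_gaussianReal v).integrable (by norm_num)
  have h2 : Integrable (fun n : ℝ => n ^ 2) (gaussianReal 0 v) :=
    (memLp_two_gaussianReal v).integrable_sq
  have he : ∀ n : ℝ, (p + q * n) ^ 2 = p ^ 2 + 2 * p * q * n + q ^ 2 * n ^ 2 := fun n => by ring
  have hl : Integrable (fun n : ℝ => p ^ 2 + 2 * p * q * n) (gaussianReal 0 v) :=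
    (integrable_const _).add (h1.const_mul _)
  have hi : Integrable (fun n : ℝ => (p + q * n) ^ 2) (gaussianReal 0 v) := by
    simp_rw [he]
    exact hl.add (h2.const_mul _)
  rw [← ofReal_integral_eq_lintegral_ofReal hi (ae_of_all _ fun x => sq_nonneg _)]
  congr 1
  simp_rw [he]
  rw [integral_add hl (h2.const_mul _),
    integral_add (integrable_const _) (h1.const_mul _), integral_const_mul, integral_const_mul,
    integral_sq_gaussianReal, integral_id_gaussianReal]
  simp

namespace Jamming

theorem lintegral_fairSign (f : ℝ → ℝ≥0∞) :
    ∫⁻ r, f r ∂fairSign = 2⁻¹ * (f 1 + f (-1)) := by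
  simp [fairSign, lintegral_add_measure, lintegral_smul_measure, mul_add]

/-- Averaging over the fair sign removes the correlation of the jamming signal with the source, so
the cost of the linear policy depends on the jammer only through its power. -/
theorem cost_linearPolicy {μX : Measure ℝ} [IsProbabilityMeasure μX]
    (hvar : MemLp (fun x : ℝ => x) 2 μX) {varX : ℝ} (hvarX : varX = ∫ x, x ^ 2 ∂μX)
    (PT PA varN : ℝ≥0) (A : Jammer) {a c : ℝ} (ha : a = gain PT varX)
    (hc : c = gain PT varX * varX / (PT + PA + varN)) :
    cost μX (gaussianReal 0 varN) (linearPolicy PT PA varN varX) A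
      = ENNReal.ofReal ((1 - c * a) ^ 2 * varX + c ^ 2 * varN)
        + ENNReal.ofReal (c ^ 2) * ∫⁻ x, ∫⁻ z, ENNReal.ofReal (z ^ 2) ∂(A.kernel x) ∂μX := by
  have := A.markov
  have hdv : cost μX (gaussianReal 0 varN) (linearPolicy PT PA varN varX) A
      = ∫⁻ r, ∫⁻ x, ∫⁻ z, ∫⁻ n,
        ENNReal.ofReal ((x - r * c * (r * a * x + z + n)) ^ 2)
          ∂(gaussianReal 0 varN) ∂(A.kernel x) ∂μX ∂fairSign := by
    rw [ha, hc]; rfl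
  have hn : ∀ r : ℝ, r ^ 2 = 1 → ∀ x z : ℝ, ∫⁻ n,
      ENNReal.ofReal ((x - r * c * (r * a * x + z + n)) ^ 2) ∂(gaussianReal 0 varN)
        = ENNReal.ofReal (((1 - c * a) * x - r * c * z) ^ 2 + c ^ 2 * varN) := by
    intro r hr x z
    have h1 : (r * c) ^ 2 = c ^ 2 := by rw [mul_pow, hr, one_mul]
    have h2 : ∀ n, x - r * c * (r * a * x + z + n)
        = ((1 - c * a) * x - r * c * z) + (-(r * c)) * n := fun n => by
      linear_combination (-(c * a * x)) * hr
    simp_rw [h2]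
    rw [lintegral_affine_sq_gaussianReal, neg_sq, h1]
  rw [hdv, lintegral_fairSign]
  simp_rw [hn 1 (by norm_num), hn (-1) (by norm_num)]
  have hm : ∀ r : ℝ, Measurable fun x => ∫⁻ z,
      ENNReal.ofReal (((1 - c * a) * x - r * c * z) ^ 2 + c ^ 2 * varN) ∂(A.kernel x) := fun r =>
    Measurable.lintegral_kernel_prod_right (κ := A.kernel)
      (f := fun x z => ENNReal.ofReal (((1 - c * a) * x - r * c * z) ^ 2 + c ^ 2 * varN))
      (by unfold Function.uncurry; fun_prop)
  rw [← lintegral_add_left (hm 1), ← lintegral_const_mul' _ _ (by simp)]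
  have hz : ∀ x : ℝ, 2⁻¹ *
      (∫⁻ z, ENNReal.ofReal (((1 - c * a) * x - 1 * c * z) ^ 2 + c ^ 2 * varN) ∂(A.kernel x)
        + ∫⁻ z, ENNReal.ofReal (((1 - c * a) * x - -1 * c * z) ^ 2 + c ^ 2 * varN) ∂(A.kernel x))
      = ENNReal.ofReal ((1 - c * a) ^ 2) * ENNReal.ofReal (x ^ 2) + ENNReal.ofReal (c ^ 2 * varN)
        + ENNReal.ofReal (c ^ 2) * ∫⁻ z, ENNReal.ofReal (z ^ 2) ∂(A.kernel x) := by
    intro x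
    rw [← lintegral_add_left (by fun_prop), ← lintegral_const_mul _ (by fun_prop),
      ← lintegral_const_mul _ (by fun_prop)]
    have hpt : ∀ z : ℝ, 2⁻¹ * (ENNReal.ofReal (((1 - c * a) * x - 1 * c * z) ^ 2 + c ^ 2 * varN)
        + ENNReal.ofReal (((1 - c * a) * x - -1 * c * z) ^ 2 + c ^ 2 * varN))
        = (ENNReal.ofReal ((1 - c * a) ^ 2) * ENNReal.ofReal (x ^ 2)
            + ENNReal.ofReal (c ^ 2 * varN))
          + ENNReal.ofReal (c ^ 2) * ENNReal.ofReal (z ^ 2) := by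
      intro z
      have h2 : (2⁻¹ : ℝ≥0∞) = ENNReal.ofReal 2⁻¹ := by
        rw [ENNReal.ofReal_inv_of_pos two_pos]; simp
      rw [h2, ← ENNReal.ofReal_mul (by positivity), ← ENNReal.ofReal_mul (by positivity),
        ← ENNReal.ofReal_add (by positivity) (by positivity),
        ← ENNReal.ofReal_add (by positivity) (by positivity),
        ← ENNReal.ofReal_add (by positivity) (by positivity), ← ENNReal.ofReal_mul (by positivity)]
      congr 1
      ring
    simp_rw [hpt]
    rw [lintegral_add_left measurable_const]
    simp
  have hmP : Measurable fun x => ∫⁻ z, ENNReal.ofReal (z ^ 2) ∂(A.kernel x) :=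
    Measurable.lintegral_kernel (by fun_prop)
  simp_rw [hz]
  rw [lintegral_add_left (by fun_prop), lintegral_add_left (by fun_prop),
    lintegral_const_mul _ (by fun_prop), lintegral_const_mul _ hmP, lintegral_ofReal_sq hvar,
    ← hvarX, lintegral_const, measure_univ, mul_one, ← ENNReal.ofReal_mul (by positivity),
    ← ENNReal.ofReal_add _ (by positivity)]
  rw [hvarX]
  exact mul_nonneg (sq_nonneg _) (integral_nonneg fun x => sq_nonneg x)

theorem linearPolicy_admissible {μX : Measure ℝ} (hvar : MemLp (fun x : ℝ => x) 2 μX) {varX : ℝ}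
    (hvarX : varX = ∫ x, x ^ 2 ∂μX) (hpos : 0 < varX) (PT PA varN : ℝ≥0) :
    (linearPolicy PT PA varN varX).Admissible μX PT := by
  have hs : ∀ r : ℝ, r ^ 2 = 1 →
      ∫⁻ x, ENNReal.ofReal ((r * gain PT varX * x) ^ 2) ∂μX = PT := by
    intro r hr
    have h1 : ∀ x : ℝ, (r * gain PT varX * x) ^ 2 = (PT / varX) * x ^ 2 := fun x => by
      rw [mul_pow, mul_pow, hr, one_mul, gain, Real.sq_sqrt (by positivity)]
    simp_rw [h1, ENNReal.ofReal_mul (show 0 ≤ (PT : ℝ) / varX by positivity)]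
    rw [lintegral_const_mul _ (by fun_prop), lintegral_ofReal_sq hvar, ← hvarX,
      ← ENNReal.ofReal_mul (by positivity), div_mul_cancel₀ _ hpos.ne', ENNReal.ofReal_coe_nnreal]
  have h : ∫⁻ r, ∫⁻ x, ENNReal.ofReal ((r * gain PT varX * x) ^ 2) ∂μX ∂fairSign ≤ PT := by
    rw [lintegral_fairSign, hs 1 (by norm_num), hs (-1) (by norm_num), ← two_mul, ← mul_assoc,
      ENNReal.inv_mul_cancel (by simp) (by simp), one_mul]
  exact h

theorem power_gaussianJammer {μX : Measure ℝ} [IsProbabilityMeasure μX] (PA : ℝ≥0) :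
    ∫⁻ x, ∫⁻ z, ENNReal.ofReal (z ^ 2) ∂((gaussianJammer PA).kernel x) ∂μX = PA := by
  simp [gaussianJammer, lintegral_sq_gaussianReal]

theorem cost_linearPolicy_gaussianJammer {μX : Measure ℝ} [IsProbabilityMeasure μX]
    (hvar : MemLp (fun x : ℝ => x) 2 μX) {varX : ℝ} (hvarX : varX = ∫ x, x ^ 2 ∂μX)
    (hpos : 0 < varX) {PT : ℝ≥0} (hPT : 0 < PT) (PA varN : ℝ≥0) :
    cost μX (gaussianReal 0 varN) (linearPolicy PT PA varN varX) (gaussianJammer PA)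
      = ENNReal.ofReal (varX * (PA + varN) / (PT + PA + varN)) := by
  rw [cost_linearPolicy hvar hvarX PT PA varN _ rfl rfl, power_gaussianJammer,
    ← ENNReal.ofReal_coe_nnreal, ← ENNReal.ofReal_mul (by positivity),
    ← ENNReal.ofReal_add (by positivity) (by positivity)]
  have hPT' : (0 : ℝ) < PT := hPT
  have hD : (0 : ℝ) < PT + PA + varN := by positivity
  have hg : gain PT varX ^ 2 = PT / varX := by rw [gain, Real.sq_sqrt (by positivity)]
  have h1 : gain PT varX * varX / (PT + PA + varN) * gain PT varX = PT / (PT + PA + varN) := by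
    calc gain PT varX * varX / (PT + PA + varN) * gain PT varX
        = gain PT varX ^ 2 * varX / (PT + PA + varN) := by ring
      _ = PT / (PT + PA + varN) := by rw [hg, div_mul_cancel₀ _ hpos.ne']
  have h2 : (gain PT varX * varX / (PT + PA + varN)) ^ 2
      = PT * varX / (PT + PA + varN) ^ 2 := by
    rw [div_pow, mul_pow, hg]
    field_simp
  rw [h1, h2]
  congr 1
  field_simp
  ring

theorem cost_linearPolicy_le_gaussianJammer {μX : Measure ℝ} [IsProbabilityMeasure μX]
    (hvar : MemLp (fun x : ℝ => x) 2 μX) {varX : ℝ} (hvarX : varX = ∫ x, x ^ 2 ∂μX)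
    (PT PA varN : ℝ≥0) {A : Jammer} (hA : A.Admissible μX PA) :
    cost μX (gaussianReal 0 varN) (linearPolicy PT PA varN varX) A
      ≤ cost μX (gaussianReal 0 varN) (linearPolicy PT PA varN varX) (gaussianJammer PA) := by
  rw [cost_linearPolicy hvar hvarX PT PA varN A rfl rfl,
    cost_linearPolicy hvar hvarX PT PA varN (gaussianJammer PA) rfl rfl, power_gaussianJammer]
  gcongr
  exact hA

end Jamming

end linear

/-! ### Low signal-to-noise ratio: the converse bound -/

section converse

open Filter Topology

/-- A shift by `y` of Gaussian noise of variance `s` decreases the expectation of a function with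
values in `[0, B]` by at most `B κ / 2` plus a multiple of `y² / s`: the likelihood ratio
`exp (y w / s - y² / (2 s))` is at least `1 + y w / s - y² / (2 s)`, and `y w` is split by the
weighted AM-GM inequality. -/
theorem lintegral_gaussianReal_le_shift {s : ℝ≥0} (hs : 0 < s) {κ B : ℝ} (hκ : 0 < κ)
    (hB : 0 ≤ B) {f : ℝ → ℝ} (hf : Measurable f) (hf0 : ∀ w, 0 ≤ f w) (hfB : ∀ w, f w ≤ B)
    (y : ℝ) :
    ∫⁻ w, ENNReal.ofReal (f w) ∂(gaussianReal 0 s)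
      ≤ ∫⁻ w, ENNReal.ofReal (f (y + w)) ∂(gaussianReal 0 s)
        + ENNReal.ofReal (B * κ / 2 + B * (1 + 1 / κ) / (2 * s) * y ^ 2) := by
  have hs' : (0 : ℝ) < s := hs
  have hshift : ∫⁻ w, ENNReal.ofReal (f (y + w)) ∂(gaussianReal 0 s)
      = ∫⁻ w, ENNReal.ofReal (f w) ∂(gaussianReal y s) := by
    rw [← lintegral_map (f := fun w => ENNReal.ofReal (f w)) (by fun_prop)
      (measurable_const_add y), gaussianReal_map_const_add, zero_add]
  have hdens : ∀ (m : ℝ) (g : ℝ → ℝ), Measurable g →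
      ∫⁻ w, ENNReal.ofReal (g w) ∂(gaussianReal m s)
        = ∫⁻ w, gaussianPDF m s w * ENNReal.ofReal (g w) := fun m g hg => by
    rw [gaussianReal_of_var_ne_zero m hs.ne',
      lintegral_withDensity_eq_lintegral_mul _ (measurable_gaussianPDF m s) (by fun_prop)]
    rfl
  set G : ℝ → ℝ := fun w => B * (κ / (2 * s) * w ^ 2 + (1 + 1 / κ) / (2 * s) * y ^ 2) with hG
  have hGm : Measurable G := by fun_prop
  have hG0 : ∀ w, 0 ≤ G w := fun w => by simp only [hG]; positivity
  have hpt : ∀ w, gaussianPDF 0 s w * ENNReal.ofReal (f w)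
      ≤ gaussianPDF y s w * ENNReal.ofReal (f w)
        + gaussianPDF 0 s w * ENNReal.ofReal (G w) := by
    intro w
    have h0 := gaussianPDFReal_nonneg 0 s w
    have hy := gaussianPDFReal_nonneg y s w
    simp only [gaussianPDF]
    rw [← ENNReal.ofReal_mul h0, ← ENNReal.ofReal_mul hy, ← ENNReal.ofReal_mul h0,
      ← ENNReal.ofReal_add (mul_nonneg hy (hf0 w)) (mul_nonneg h0 (hG0 w))]
    apply ENNReal.ofReal_le_ofReal
    have hratio : gaussianPDFReal y s w
        = gaussianPDFReal 0 s w * Real.exp (y * w / s - y ^ 2 / (2 * s)) := by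
      simp only [gaussianPDFReal]
      rw [mul_assoc (Real.sqrt (2 * Real.pi * s))⁻¹, ← Real.exp_add]
      congr 2
      field_simp
      ring
    have hexp := Real.add_one_le_exp (y * w / s - y ^ 2 / (2 * s))
    have hamgm : -(y * w / s) ≤ κ / (2 * s) * w ^ 2 + 1 / κ / (2 * s) * y ^ 2 := by
      have : κ / (2 * s) * w ^ 2 + 1 / κ / (2 * s) * y ^ 2 + y * w / s
          = (κ * w + y) ^ 2 / (2 * s * κ) := by field_simp; ring
      have h2 : 0 ≤ (κ * w + y) ^ 2 / (2 * s * κ) := by positivity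
      linarith
    set D : ℝ := κ / (2 * s) * w ^ 2 + (1 + 1 / κ) / (2 * s) * y ^ 2 with hD
    have hD0 : 0 ≤ D := by positivity
    have hlow : 1 - D ≤ Real.exp (y * w / s - y ^ 2 / (2 * s)) := by
      have : D = κ / (2 * s) * w ^ 2 + 1 / κ / (2 * s) * y ^ 2 + y ^ 2 / (2 * s) := by
        rw [hD]; ring
      linarith
    have hfD : f w * D ≤ B * D := mul_le_mul_of_nonneg_right (hfB w) hD0
    have h3 : f w ≤ Real.exp (y * w / s - y ^ 2 / (2 * s)) * f w + B * D := by
      nlinarith [mul_le_mul_of_nonneg_left hlow (hf0 w)]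
    calc gaussianPDFReal 0 s w * f w
        ≤ gaussianPDFReal 0 s w * (Real.exp (y * w / s - y ^ 2 / (2 * s)) * f w + B * D) := by
          gcongr
      _ = gaussianPDFReal y s w * f w + gaussianPDFReal 0 s w * G w := by
          rw [hratio]; ring
  have hGint : ∫⁻ w, ENNReal.ofReal (G w) ∂(gaussianReal 0 s)
      = ENNReal.ofReal (B * κ / 2 + B * (1 + 1 / κ) / (2 * s) * y ^ 2) := by
    have h1 : ∀ w, ENNReal.ofReal (G w) = ENNReal.ofReal (B * (κ / (2 * s)))
        * ENNReal.ofReal (w ^ 2) + ENNReal.ofReal (B * (1 + 1 / κ) / (2 * s) * y ^ 2) := by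
      intro w
      rw [← ENNReal.ofReal_mul (by positivity), ← ENNReal.ofReal_add (by positivity)
        (by positivity)]
      congr 1
      simp only [hG]
      ring
    simp_rw [h1]
    rw [lintegral_add_right _ measurable_const, lintegral_const_mul _ (by fun_prop),
      lintegral_sq_gaussianReal, lintegral_const, measure_univ, mul_one,
      ← ENNReal.ofReal_coe_nnreal, ← ENNReal.ofReal_mul (by positivity),
      ← ENNReal.ofReal_add (by positivity) (by positivity)]
    congr 2
    field_simp
  have hm : Measurable fun w => gaussianPDF y s w * ENNReal.ofReal (f w) :=
    (measurable_gaussianPDF y s).mul (by fun_prop)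
  rw [hshift, ← hGint, hdens 0 f hf, hdens y f hf, hdens 0 G hGm,
    ← lintegral_add_left hm]
  exact lintegral_mono hpt

/-- On a large interval a centered source already has nearly its full variance about *every*
point, as its mass there tends to `1` and its first moment there to `0`. -/
theorem exists_truncated_variance_le {μ : Measure ℝ} [IsProbabilityMeasure μ]
    (hvar : MemLp (fun x : ℝ => x) 2 μ) (hmean : ∫ x, x ∂μ = 0) {v : ℝ}
    (hv : v = ∫ x, x ^ 2 ∂μ) {ε : ℝ} (hε : 0 < ε) :
    ∃ K : ℝ, 0 < K ∧ ∀ a : ℝ,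
      ENNReal.ofReal (v - ε) ≤ ∫⁻ x in Set.Icc (-K) K, ENNReal.ofReal ((x - a) ^ 2) ∂μ := by
  have h1 : Integrable (fun x : ℝ => x) μ := hvar.integrable (by norm_num)
  have h2 : Integrable (fun x : ℝ => x ^ 2) μ := hvar.integrable_sq
  have hU : ⋃ K : ℝ, Set.Icc (-K) K = Set.univ := by
    refine Set.eq_univ_of_forall fun x => Set.mem_iUnion.2 ⟨|x|, ?_⟩
    exact abs_le.1 le_rfl
  have hlim : ∀ f : ℝ → ℝ, Integrable f μ →
      Tendsto (fun K : ℝ => ∫ x in Set.Icc (-K) K, f x ∂μ) atTop (𝓝 (∫ x, f x ∂μ)) := by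
    intro f hf
    have h := tendsto_setIntegral_of_monotone (μ := μ) (f := f)
      (s := fun K : ℝ => Set.Icc (-K) K) (fun K => measurableSet_Icc)
      (fun K L hKL => Set.Icc_subset_Icc (neg_le_neg hKL) hKL) hf.integrableOn
    rwa [hU, setIntegral_univ] at h
  have t0 := hlim (fun _ => 1) (integrable_const _)
  have t1 := hlim _ h1
  have t2 := hlim _ h2
  rw [hmean] at t1
  rw [← hv] at t2
  have t3 : Tendsto (fun K : ℝ => (∫ x in Set.Icc (-K) K, x ^ 2 ∂μ)
      - 2 * (∫ x in Set.Icc (-K) K, x ∂μ) ^ 2) atTop (𝓝 v) := by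
    have := t2.sub ((t1.pow 2).const_mul 2)
    simpa using this
  have e0 := t0.eventually_const_le (show (1 / 2 : ℝ) < ∫ _, (1 : ℝ) ∂μ by simp; norm_num)
  have e3 := t3.eventually_const_le (show v - ε < v by linarith)
  obtain ⟨K, hK0, hK3, hK⟩ := (e0.and (e3.and (eventually_gt_atTop (0 : ℝ)))).exists
  refine ⟨K, hK, fun a => ?_⟩
  set ν := μ.restrict (Set.Icc (-K) K)
  have i1 : Integrable (fun x : ℝ => x) ν := h1.restrict
  have i2 : Integrable (fun x : ℝ => x ^ 2) ν := h2.restrict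
  have he : ∀ x : ℝ, (x - a) ^ 2 = x ^ 2 + (-(2 * a)) * x + a ^ 2 * 1 := fun x => by ring
  have il : Integrable (fun x : ℝ => x ^ 2 + (-(2 * a)) * x) ν := i2.add (i1.const_mul _)
  have ic : Integrable (fun _ : ℝ => a ^ 2 * (1 : ℝ)) ν := integrable_const _
  have hi : Integrable (fun x : ℝ => (x - a) ^ 2) ν := by
    simp_rw [he]
    exact il.add ic
  rw [← ofReal_integral_eq_lintegral_ofReal hi (ae_of_all _ fun x => sq_nonneg _)]
  apply ENNReal.ofReal_le_ofReal
  refine hK3.trans ?_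
  simp_rw [he]
  rw [integral_add il ic, integral_add i2 (i1.const_mul _), integral_const_mul,
    integral_const_mul]
  have hsq := sq_nonneg (a - 2 * ∫ x, x ∂ν)
  nlinarith [mul_le_mul_of_nonneg_left hK0 (sq_nonneg a)]

namespace Jamming

/-- Independent Gaussian jamming merely raises the noise variance. -/
theorem cost_gaussianJammer (μX : Measure ℝ) [SFinite μX] (PA varN : ℝ≥0) (p : CommPolicy) :
    cost μX (gaussianReal 0 varN) p (gaussianJammer PA)
      = ∫⁻ r, ∫⁻ x, ∫⁻ w, ENNReal.ofReal ((x - p.dec r (p.enc r x + w)) ^ 2)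
          ∂(gaussianReal 0 (PA + varN)) ∂μX ∂p.seed := by
  refine lintegral_congr fun r => lintegral_congr fun x => ?_
  have hd : Measurable (p.dec r) := p.measurable_dec.of_uncurry_left
  have hconv := gaussianReal_conv_gaussianReal (m₁ := 0) (m₂ := 0) (v₁ := PA) (v₂ := varN)
  rw [add_zero] at hconv
  rw [← hconv, Measure.lintegral_conv (by fun_prop)]
  simp only [gaussianJammer, Kernel.const_apply, add_assoc]

/-- At low signal-to-noise ratio a receiver facing Gaussian jamming can do hardly better than the
constant estimate `0`, whatever the encoder. The estimate is clipped to a large interval `[-K, K]`,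
and the squared error is restricted to the event `|X| ≤ K`, which makes the loss bounded; the
received signal may then be replaced by noise independent of the source. -/
theorem exists_variance_le_cost_gaussianJammer {μX : Measure ℝ} [IsProbabilityMeasure μX]
    (hvar : MemLp (fun x : ℝ => x) 2 μX) (hmean : ∫ x, x ∂μX = 0) {varX : ℝ}
    (hvarX : varX = ∫ x, x ^ 2 ∂μX) {ε : ℝ} (hε : 0 < ε) :
    ∃ b₀ : ℝ, 0 < b₀ ∧ ∀ PT PA varN : ℝ≥0, 0 < PT → 0 < varN → b₀ ≤ invCSNR PT PA varN →
      ∀ p : CommPolicy, p.Admissible μX PT →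
        ENNReal.ofReal varX
          ≤ cost μX (gaussianReal 0 varN) p (gaussianJammer PA) + ENNReal.ofReal ε := by
  obtain ⟨K, hK, hKv⟩ := exists_truncated_variance_le hvar hmean hvarX (half_pos hε)
  set B : ℝ := 4 * K ^ 2 with hB
  have hB0 : 0 < B := by positivity
  -- with these choices `B κ / 2 = ε / 4` and `B (1 + 1 / κ) / (2 b₀) = ε / 4`
  set κ : ℝ := ε / (2 * B) with hκ
  have hκ0 : 0 < κ := by positivity
  refine ⟨2 * B * (1 + 1 / κ) / ε, by positivity, fun PT PA varN hPT hN hb p hp => ?_⟩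
  have := p.seed_prob
  set s : ℝ≥0 := PA + varN with hs
  have hs0 : 0 < s := by positivity
  set S : Set ℝ := Set.Icc (-K) K with hS
  set clip : ℝ → ℝ := fun d => max (-K) (min K d) with hclip
  have hclip_mem : ∀ d, clip d ∈ S := fun d =>
    ⟨le_max_left _ _, max_le (by linarith) (min_le_left _ _)⟩
  have hclip_meas : Measurable clip := by fun_prop
  have hclip_le : ∀ x ∈ S, ∀ d, (x - clip d) ^ 2 ≤ (x - d) ^ 2 := by
    rintro x ⟨hx1, hx2⟩ d
    apply sq_le_sq.2
    simp only [hclip]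
    rcases le_total K d with h | h
    · rw [min_eq_left h, max_eq_right (by linarith), abs_of_nonpos (by linarith),
        abs_of_nonpos (by linarith)]
      linarith
    · rw [min_eq_right h]
      rcases le_total (-K) d with h' | h'
      · rw [max_eq_right h']
      · rw [max_eq_left h', abs_of_nonneg (by linarith), abs_of_nonneg (by linarith)]
        linarith
  have hclip_B : ∀ x ∈ S, ∀ d, (x - clip d) ^ 2 ≤ B := by
    rintro x ⟨hx1, hx2⟩ d
    obtain ⟨h1, h2⟩ := hclip_mem d
    have : |x - clip d| ≤ 2 * K := abs_le.2 ⟨by linarith, by linarith⟩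
    calc (x - clip d) ^ 2 = |x - clip d| ^ 2 := (sq_abs _).symm
      _ ≤ (2 * K) ^ 2 := by gcongr
      _ = B := by rw [hB]; ring
  set D : ℝ := B * (1 + 1 / κ) / (2 * s) with hD
  have hs0' : (0 : ℝ) < s := hs0
  have hD0 : 0 ≤ D := by positivity
  have hdec : ∀ r, Measurable (p.dec r) := fun r => p.measurable_dec.of_uncurry_left
  have henc : ∀ r, Measurable (p.enc r) := fun r => p.measurable_enc.of_uncurry_left
  have hψ : Measurable fun q : ℝ × ℝ => ∫⁻ w, ENNReal.ofReal
      ((q.2 - p.dec q.1 (p.enc q.1 q.2 + w)) ^ 2) ∂(gaussianReal 0 s) := by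
    have h1 : Measurable fun t : (ℝ × ℝ) × ℝ => p.enc t.1.1 t.1.2 :=
      p.measurable_enc.comp measurable_fst
    have h2 : Measurable fun t : (ℝ × ℝ) × ℝ => p.dec t.1.1 (p.enc t.1.1 t.1.2 + t.2) :=
      p.measurable_dec.comp ((measurable_fst.comp measurable_fst).prodMk (h1.add measurable_snd))
    refine Measurable.lintegral_prod_right' (f := fun t : (ℝ × ℝ) × ℝ => ENNReal.ofReal
      ((t.1.2 - p.dec t.1.1 (p.enc t.1.1 t.1.2 + t.2)) ^ 2)) ?_
    fun_prop
  have hψr : ∀ r, Measurable fun x => ∫⁻ w, ENNReal.ofReal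
      ((x - p.dec r (p.enc r x + w)) ^ 2) ∂(gaussianReal 0 s) := fun r =>
    hψ.comp (measurable_const.prodMk measurable_id)
  -- the loss of a receiver whose input is independent of the source
  have hlow : ∀ r, ENNReal.ofReal (varX - ε / 2) ≤ ∫⁻ x in S, ∫⁻ w,
      ENNReal.ofReal ((x - clip (p.dec r w)) ^ 2) ∂(gaussianReal 0 s) ∂μX := by
    intro r
    have := hdec r
    rw [lintegral_lintegral_swap (by unfold Function.uncurry; fun_prop)]
    calc ENNReal.ofReal (varX - ε / 2)
        = ∫⁻ _, ENNReal.ofReal (varX - ε / 2) ∂(gaussianReal 0 s) := by simp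
      _ ≤ _ := lintegral_mono fun w => hKv _
  have hstep : ∀ r, ENNReal.ofReal (varX - ε / 2)
      ≤ ∫⁻ x, ∫⁻ w, ENNReal.ofReal ((x - p.dec r (p.enc r x + w)) ^ 2) ∂(gaussianReal 0 s) ∂μX
        + (ENNReal.ofReal (ε / 4)
          + ENNReal.ofReal D * ∫⁻ x, ENNReal.ofReal (p.enc r x ^ 2) ∂μX) := by
    intro r
    have hdr := hdec r
    have her := henc r
    refine (hlow r).trans ?_
    have hx : ∀ x ∈ S, ∫⁻ w, ENNReal.ofReal ((x - clip (p.dec r w)) ^ 2) ∂(gaussianReal 0 s)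
        ≤ ∫⁻ w, ENNReal.ofReal ((x - p.dec r (p.enc r x + w)) ^ 2) ∂(gaussianReal 0 s)
          + (ENNReal.ofReal (ε / 4) + ENNReal.ofReal D * ENNReal.ofReal (p.enc r x ^ 2)) := by
      intro x hxS
      refine (lintegral_gaussianReal_le_shift hs0 hκ0 hB0.le
        (f := fun w => (x - clip (p.dec r w)) ^ 2) (by fun_prop) (fun w => sq_nonneg _)
        (fun w => hclip_B x hxS _) (p.enc r x)).trans ?_
      refine add_le_add
        (lintegral_mono fun w => ENNReal.ofReal_le_ofReal (hclip_le x hxS _)) (le_of_eq ?_)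
      rw [ENNReal.ofReal_add (by positivity) (by positivity), ENNReal.ofReal_mul hD0]
      congr 2
      rw [hκ]; field_simp; norm_num
    refine (setLIntegral_mono' measurableSet_Icc hx).trans
      ((setLIntegral_le_lintegral _ _).trans (le_of_eq ?_))
    rw [lintegral_add_left (hψr r), lintegral_add_left measurable_const,
      lintegral_const_mul _ (by fun_prop)]
    simp
  have hDPT : D * PT ≤ ε / 4 := by
    have hPT' : (0 : ℝ) < PT := hPT
    have hb' : 2 * B * (1 + 1 / κ) / ε ≤ s / PT := by
      simpa [invCSNR, hs] using hb
    rw [div_le_div_iff₀ hε hPT'] at hb'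
    rw [hD, div_mul_eq_mul_div, div_le_div_iff₀ (by positivity) (by norm_num)]
    linarith
  have hP : Measurable fun r => ∫⁻ x, ENNReal.ofReal (p.enc r x ^ 2) ∂μX := by
    have := p.measurable_enc
    exact Measurable.lintegral_prod_right'
      (f := fun q : ℝ × ℝ => ENNReal.ofReal (Function.uncurry p.enc q ^ 2)) (by fun_prop)
  have htotal : ENNReal.ofReal (varX - ε / 2)
      ≤ cost μX (gaussianReal 0 varN) p (gaussianJammer PA) + ENNReal.ofReal (ε / 2) := by
    rw [cost_gaussianJammer]
    calc ENNReal.ofReal (varX - ε / 2)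
        = ∫⁻ _, ENNReal.ofReal (varX - ε / 2) ∂p.seed := by simp
      _ ≤ _ := lintegral_mono hstep
      _ = ∫⁻ r, ∫⁻ x, ∫⁻ w, ENNReal.ofReal ((x - p.dec r (p.enc r x + w)) ^ 2)
            ∂(gaussianReal 0 s) ∂μX ∂p.seed
          + (ENNReal.ofReal (ε / 4) + ENNReal.ofReal D
            * ∫⁻ r, ∫⁻ x, ENNReal.ofReal (p.enc r x ^ 2) ∂μX ∂p.seed) := by
          rw [lintegral_add_left hψ.lintegral_prod_right', lintegral_add_left measurable_const,
            lintegral_const_mul _ hP]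
          simp
      _ ≤ _ := by
          gcongr
          calc ENNReal.ofReal (ε / 4) + ENNReal.ofReal D
                * ∫⁻ r, ∫⁻ x, ENNReal.ofReal (p.enc r x ^ 2) ∂μX ∂p.seed
              ≤ ENNReal.ofReal (ε / 4) + ENNReal.ofReal D * PT := by
                gcongr
                exact hp
            _ ≤ ENNReal.ofReal (ε / 4) + ENNReal.ofReal (ε / 4) := by
                gcongr
                rw [← ENNReal.ofReal_coe_nnreal, ← ENNReal.ofReal_mul hD0]
                exact ENNReal.ofReal_le_ofReal hDPT
            _ = ENNReal.ofReal (ε / 2) := by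
                rw [← ENNReal.ofReal_add (by positivity) (by positivity)]
                congr 1; ring
  calc ENNReal.ofReal varX
      = ENNReal.ofReal (varX - ε / 2 + ε / 2) := by congr 1; ring
    _ ≤ ENNReal.ofReal (varX - ε / 2) + ENNReal.ofReal (ε / 2) := ENNReal.ofReal_add_le
    _ ≤ cost μX (gaussianReal 0 varN) p (gaussianJammer PA) + ENNReal.ofReal (ε / 2)
          + ENNReal.ofReal (ε / 2) := by gcongr
    _ = cost μX (gaussianReal 0 varN) p (gaussianJammer PA) + ENNReal.ofReal ε := by
        rw [add_assoc, ← ENNReal.ofReal_add (by positivity) (by positivity)]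
        congr 2; ring

end Jamming

end converse

/-! ### The saddle point -/

theorem variance_pos_of_absolutelyContinuous {μ : Measure ℝ} [IsProbabilityMeasure μ]
    (hd : μ ≪ volume) (hvar : MemLp (fun x : ℝ => x) 2 μ) : 0 < ∫ x, x ^ 2 ∂μ := by
  refine lt_of_le_of_ne (integral_nonneg fun x => sq_nonneg x) fun h0 => ?_
  have hae := (integral_eq_zero_iff_of_nonneg (fun x : ℝ => sq_nonneg x)
    hvar.integrable_sq).1 h0.symm
  have h1 : ∀ᵐ x ∂μ, x ∈ ({0} : Set ℝ) := by
    filter_upwards [hae] with x hx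
    simpa using hx
  have h2 : μ {0} = 1 := by
    rw [← measure_univ (μ := μ)]; exact measure_congr (Filter.eventuallyEq_univ.2 h1)
  exact zero_ne_one ((hd (Real.volume_singleton (a := 0))).symm.trans h2)

theorem charFun_gaussianReal_zero (v : ℝ≥0) (ω : ℝ) :
    charFun (gaussianReal 0 v) ω = (Real.exp (-(v * ω ^ 2 / 2)) : ℂ) := by
  rw [charFun_gaussianReal]
  push_cast
  congr 1
  ring

theorem theorem7 (μX : Measure ℝ) [IsProbabilityMeasure μX]
    (hdens : μX ≪ volume) (hvar : MemLp (fun x : ℝ => x) 2 μX) (hmean : ∫ x, x ∂μX = 0)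
    (varX : ℝ) (hvarX : varX = ∫ x, x ^ 2 ∂μX) :
    ∀ ε : ℝ, 0 < ε → ∀ T : ℝ, 0 < T → ∃ β₀ : ℝ, 0 < β₀ ∧
      ∀ PT PA varN : ℝ≥0, 0 < PT → 0 < varN → β₀ ≤ Jamming.invCSNR PT PA varN →
        -- the matching condition `F_Z F_N = F_X^β (α_T ·)` holds up to `ε`, at all frequencies
        (∀ ω : ℝ,
          ‖charFun (gaussianReal 0 PA) ω * charFun (gaussianReal 0 varN) ω
            - charFun μX (Jamming.gain PT varX * ω) ^ (Jamming.invCSNR PT PA varN : ℂ)‖ ≤ ε) ∧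
        -- the same in the form `F_Z = F_X^β (α_T ·) / F_N`, on the scale of the total noise
        (∀ ω : ℝ, |ω| * Real.sqrt (PA + varN) ≤ T →
          ‖charFun (gaussianReal 0 PA) ω
            - charFun μX (Jamming.gain PT varX * ω) ^ (Jamming.invCSNR PT PA varN : ℂ)
                / charFun (gaussianReal 0 varN) ω‖ ≤ ε) ∧
        -- Gaussian jamming and the randomized linear policy form a saddle point up to `ε`
        Jamming.IsSaddleUpTo (ENNReal.ofReal ε) μX (gaussianReal 0 varN) PT PA
          (Jamming.linearPolicy PT PA varN varX) (Jamming.gaussianJammer PA) ∧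
        -- its cost
        Jamming.cost μX (gaussianReal 0 varN) (Jamming.linearPolicy PT PA varN varX)
            (Jamming.gaussianJammer PA)
          = ENNReal.ofReal (varX * (PA + varN) / (PT + PA + varN)) ∧
        -- no admissible jammer guarantees a distortion larger by more than `ε`
        (∀ A : Jamming.Jammer, A.Admissible μX PA →
          Jamming.guaranteedCost μX (gaussianReal 0 varN) PT A
            ≤ Jamming.guaranteedCost μX (gaussianReal 0 varN) PT (Jamming.gaussianJammer PA)
              + ENNReal.ofReal ε) := by
  intro ε hε T hT
  have hpos : 0 < varX := hvarX ▸ variance_pos_of_absolutelyContinuous hdens hvar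
  -- one threshold serves both matching conditions: dividing by `F_N` costs a factor of at most
  -- `exp (T² / 2)` in the given range of frequencies
  set ε₁ : ℝ := ε * Real.exp (-(T ^ 2 / 2)) with hε₁
  have hε₁0 : 0 < ε₁ := by positivity
  have hε₁ε : ε₁ ≤ ε :=
    mul_le_of_le_one_right hε.le (Real.exp_le_one_iff.2 (by linarith [sq_nonneg T]))
  obtain ⟨b₁, hb₁, hmatch⟩ :=
    exists_charFun_cpow_close_gaussian hdens hvar hmean hvarX hpos hε₁0
  obtain ⟨b₂, hb₂, hconv⟩ :=
    Jamming.exists_variance_le_cost_gaussianJammer hvar hmean hvarX hε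
  refine ⟨max b₁ b₂, lt_max_of_lt_left hb₁, fun PT PA varN hPT hN hb => ?_⟩
  have hPT' : (0 : ℝ) < PT := hPT
  have hN' : (0 : ℝ) < varN := hN
  have hclose : ∀ ω : ℝ,
      ‖charFun (gaussianReal 0 PA) ω * charFun (gaussianReal 0 varN) ω
        - charFun μX (Jamming.gain PT varX * ω) ^ (Jamming.invCSNR PT PA varN : ℂ)‖ ≤ ε₁ := by
    intro ω
    have h := hmatch _ ((le_max_left _ _).trans hb) (Jamming.gain PT varX * ω)
    have he : Jamming.invCSNR PT PA varN * varX * (Jamming.gain PT varX * ω) ^ 2 / 2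
        = PA * ω ^ 2 / 2 + varN * ω ^ 2 / 2 := by
      rw [mul_pow, Jamming.gain, Real.sq_sqrt (by positivity), Jamming.invCSNR]
      field_simp
    rw [he] at h
    rw [norm_sub_rev, charFun_gaussianReal_zero, charFun_gaussianReal_zero, ← Complex.ofReal_mul,
      ← Real.exp_add, ← neg_add]
    exact h
  have hcost := Jamming.cost_linearPolicy_gaussianJammer hvar hvarX hpos hPT PA varN
  have hsaddle : ∀ p' : Jamming.CommPolicy, p'.Admissible μX PT →
      Jamming.cost μX (gaussianReal 0 varN) (Jamming.linearPolicy PT PA varN varX)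
          (Jamming.gaussianJammer PA)
        ≤ Jamming.cost μX (gaussianReal 0 varN) p' (Jamming.gaussianJammer PA)
          + ENNReal.ofReal ε := by
    intro p' hp'
    refine le_trans ?_ (hconv PT PA varN hPT hN ((le_max_right _ _).trans hb) p' hp')
    rw [hcost]
    apply ENNReal.ofReal_le_ofReal
    rw [div_le_iff₀ (by positivity)]
    gcongr
    linarith
  have hlin := Jamming.linearPolicy_admissible hvar hvarX hpos PT PA varN
  refine ⟨fun ω => (hclose ω).trans hε₁ε, fun ω hω => ?_,
    ⟨hlin, (Jamming.power_gaussianJammer PA).le,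
      fun A' hA' => Jamming.cost_linearPolicy_le_gaussianJammer hvar hvarX PT PA varN hA',
      hsaddle⟩, hcost, fun A hA => ?_⟩
  · have hF := charFun_gaussianReal_zero varN ω
    have hF0 : charFun (gaussianReal 0 varN) ω ≠ 0 := by
      rw [hF]; exact_mod_cast (Real.exp_pos _).ne'
    have hnorm : Real.exp (-(T ^ 2 / 2)) ≤ ‖charFun (gaussianReal 0 varN) ω‖ := by
      rw [hF, Complex.norm_real, Real.norm_of_nonneg (Real.exp_pos _).le, Real.exp_le_exp,
        neg_le_neg_iff]
      have h1 : (|ω| * Real.sqrt (PA + varN)) ^ 2 ≤ T ^ 2 := by gcongr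
      rw [mul_pow, sq_abs, Real.sq_sqrt (by positivity)] at h1
      nlinarith [mul_nonneg (sq_nonneg ω) PA.coe_nonneg]
    rw [← mul_div_cancel_right₀ (charFun (gaussianReal 0 PA) ω) hF0, ← sub_div, norm_div,
      div_le_iff₀ (norm_pos_iff.2 hF0)]
    exact (hclose ω).trans (by rw [hε₁]; gcongr)
  · calc Jamming.guaranteedCost μX (gaussianReal 0 varN) PT A
        ≤ Jamming.cost μX (gaussianReal 0 varN) (Jamming.linearPolicy PT PA varN varX) A :=
          iInf₂_le (f := fun (p : Jamming.CommPolicy) (_ : p.Admissible μX PT) =>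
            Jamming.cost μX (gaussianReal 0 varN) p A) _ hlin
      _ ≤ Jamming.cost μX (gaussianReal 0 varN) (Jamming.linearPolicy PT PA varN varX)
            (Jamming.gaussianJammer PA) :=
          Jamming.cost_linearPolicy_le_gaussianJammer hvar hvarX PT PA varN hA
      _ ≤ _ := by
          rw [← tsub_le_iff_right]
          exact le_iInf₂ fun p' hp' => tsub_le_iff_right.2 (hsaddle p' hp')
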